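/- A parsing expression grammar (PEG) over a finite alphabet $\Sigma$ consists of a finite set of non-terminals (disjoint from $\Sigma$), a starting non-terminal $S$, and a rule $R$ assigning to each non-terminal a parsing expression, where parsing expressions are built from $\varepsilon$, $\mathsf{FAIL}$, terminals and non-terminals by $!e$, $\&e$, sequence $e_1e_2$ and ordered choice $e_1/e_2$. The recognition procedure $\mathsf{Rec}(e,x)$ returns either a consumed prefix of $x$ or $\mathsf{FAIL}$, or loops forever, with the usual recursive semantics: $\varepsilon$ consumes the empty word; $\mathsf{FAIL}$ fails; a terminal $a$ consumes $a$ if $x$ starts with $a$ and fails otherwise; $!e$ consumes the empty word if $e$ fails on $x$, and fails if $e$ accepts a prefix of $x$; $\&e$ consumes the empty word if $e$ accepts a prefix of $x$, and fails if $e$ fails; $e_1e_2$ runs $e_1$ on $x$ and then $e_2$ on what remains, and fails if either fails; $e_1/e_2$ runs $e_1$, and runs $e_2$ on $x$ if $e_1$ fails; a non-terminal $A$ behaves as $R(A)$. A PEG is total if this procedure terminates for every expression and every input. $\mathsf{PEG}$ is the class of languages of the form $\{x\in\Sigma^* : \mathsf{Rec}(S,x)=x\}$ for a total PEG. For $L\subseteq\Sigma^*$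 and $\ell,m\in\mathbb N$, let $E_L(\ell,m)$ be the number of equivalence classes of the relation on $\Sigma^\ell$ given by $y_1\equiv y_2 \iff \forall x\in\Sigma^m\,(y_1x\in L\Leftrightarrow y_2x\in L)$. An online Turing machine is a deterministic Turing machine with a read-only input tape whose head starts on the first input symbol and moves only to the right, finitely many read-write work tapes, and a further read-write auxiliary tape that initially holds the input length in binary. For $t:\mathbb N\to\mathbb R$, $\mathsf{Online}(t(n))$ is the class of languages decided by such a machine which, on every input of every length $n$, halts with the correct answer and makes at most $t(n)$ steps before it finishes with the first input symbol, between reading any two consecutive input symbols, and after reaching the end of the input (precisely: the input head never stays on one input symbol, or on the end of the input, for more than $t(n)$ steps; moves of the input head are not themselves counted). **Theorem.** There is a language $K\subseteq\{0,1,\#\}^*$ in $\mathsf{PEG}$ such that $$E_K\big((D+1)\cdot 2^D,\,D\big)\ \ge\ 2^{2^D}\qquad\text{for all } D\in\mathbb N,$$ and moreover $K\notin\mathsf{Online}(t(n))$ for every $t:\mathbb N\to\mathbb R$ with $t(n)=o\big(n/(\log n)^2\big)$ as $n\to\infty$. -/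

import Mathlib

/-! ## Parsing expression grammars -/

/-- Parsing expressions over terminal symbols `α` and non-terminal symbols `N`
(two separate types, hence disjoint). -/
inductive PExp (α N : Type) : Type
  | eps : PExp α N
  | fail : PExp α N
  | term (a : α) : PExp α N
  | nonterm (A : N) : PExp α N
  | notP (e : PExp α N) : PExp α N
  | andP (e : PExp α N) : PExp α N
  | seq (e₁ e₂ : PExp α N) : PExp α N
  | alt (e₁ e₂ : PExp α N) : PExp α N

/-- A parsing expression grammar with terminal alphabet `α`. -/
structure PEG (α : Type) where
  NT : Type
  finiteNT : Finite NT
  rule : NT → PExp α NT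
  start : NT

namespace PEG

variable {α : Type}

/-- `G.Rec e x r`: the recognition procedure, called on the expression `e` and the input `x`,
terminates and returns `r`. The value `some y` means that the prefix `y` of `x` is consumed, and
`none` means `FAIL`. There is no `r` with `G.Rec e x r` when the procedure loops forever. -/
inductive Rec (G : PEG α) : PExp α G.NT → List α → Option (List α) → Prop
  | eps (x : List α) : Rec G .eps x (some [])
  | fail (x : List α) : Rec G .fail x none
  | term_hit (a : α) (x z : List α) : x = a :: z → Rec G (.term a) x (some [a])
  | term_miss (a : α) (x : List α) : (¬ ∃ z, x = a :: z) → Rec G (.term a) x none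
  | not_of_fail (e : PExp α G.NT) (x : List α) : Rec G e x none → Rec G (.notP e) x (some [])
  | not_of_accept (e : PExp α G.NT) (x y : List α) :
      Rec G e x (some y) → Rec G (.notP e) x none
  | and_of_accept (e : PExp α G.NT) (x y : List α) :
      Rec G e x (some y) → Rec G (.andP e) x (some [])
  | and_of_fail (e : PExp α G.NT) (x : List α) : Rec G e x none → Rec G (.andP e) x none
  | seq_accept (e₁ e₂ : PExp α G.NT) (x y₁ z y₂ : List α) :
      Rec G e₁ x (some y₁) → x = y₁ ++ z → Rec G e₂ z (some y₂) →
      Rec G (.seq e₁ e₂) x (some (y₁ ++ y₂))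
  | seq_fail_left (e₁ e₂ : PExp α G.NT) (x : List α) :
      Rec G e₁ x none → Rec G (.seq e₁ e₂) x none
  | seq_fail_right (e₁ e₂ : PExp α G.NT) (x y₁ z : List α) :
      Rec G e₁ x (some y₁) → x = y₁ ++ z → Rec G e₂ z none → Rec G (.seq e₁ e₂) x none
  | alt_left (e₁ e₂ : PExp α G.NT) (x y : List α) :
      Rec G e₁ x (some y) → Rec G (.alt e₁ e₂) x (some y)
  | alt_right (e₁ e₂ : PExp α G.NT) (x : List α) (r : Option (List α)) :
      Rec G e₁ x none → Rec G e₂ x r → Rec G (.alt e₁ e₂) x r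
  | nonterm (A : G.NT) (x : List α) (r : Option (List α)) :
      Rec G (G.rule A) x r → Rec G (.nonterm A) x r

/-- The recognition procedure terminates on every expression and every input. -/
def Total (G : PEG α) : Prop :=
  ∀ (e : PExp α G.NT) (x : List α), ∃ r, G.Rec e x r

/-- The words that the starting non-terminal accepts and consumes entirely. -/
def language (G : PEG α) : Language α :=
  {x | G.Rec (.nonterm G.start) x (some x)}

end PEG

/-- The class of languages recognised by total parsing expression grammars. -/
def PEGLanguages (α : Type) : Set (Language α) :=
  {L | ∃ G : PEG α, G.Total ∧ G.language = L}

/-! ## Online Turing machines -/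

/-- Symbols on the tapes of an online Turing machine: the blank, the two binary digits (needed to
write the input size on the auxiliary tape), and further symbols from `Γ`. -/
inductive TapeSymbol (Γ : Type) : Type
  | blank : TapeSymbol Γ
  | bit (b : Bool) : TapeSymbol Γ
  | sym (g : Γ) : TapeSymbol Γ

instance (Γ : Type) : Inhabited (TapeSymbol Γ) := ⟨.blank⟩

/-- A deterministic online Turing machine with input alphabet `α`. Besides the input tape it has
`k + 1` two-way infinite read-write tapes: tape `0` is the auxiliary tape, the others are work
tapes. From the state, the scanned input symbol (`none` at the end of the input) and the scanned
tape symbols, the transition function either halts (`none`) or gives the new state, whether the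
input head moves to the right, and for each tape the symbol to write and the head movement
(`none` means that the head does not move). -/
structure OnlineTM (α : Type) where
  Q : Type
  finiteQ : Finite Q
  Γ : Type
  finiteΓ : Finite Γ
  k : ℕ
  start : Q
  accepting : Set Q
  δ : Q → Option α → (Fin (k + 1) → TapeSymbol Γ) →
    Option (Q × Bool × (Fin (k + 1) → TapeSymbol Γ × Option Turing.Dir))

/-- The shortest binary representation of a natural number, most significant digit first. -/
def binaryDigits (n : ℕ) : List Bool :=
  if n = 0 then [false] else n.bits.reverse

namespace OnlineTM

variable {α : Type}

/-- A configuration; `rest` is the part of the input from the input head onwards. -/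
structure Config (M : OnlineTM α) where
  state : M.Q
  rest : List α
  tape : Fin (M.k + 1) → Turing.Tape (TapeSymbol M.Γ)

/-- Initially the input head is on the first input symbol, the auxiliary tape holds the input
size in binary (with its head on the first digit), and the work tapes are blank. -/
def init (M : OnlineTM α) (x : List α) : M.Config where
  state := M.start
  rest := x
  tape := fun i =>
    if i = 0 then Turing.Tape.mk₁ ((binaryDigits x.length).map TapeSymbol.bit)
    else Turing.Tape.mk₁ []

/-- Move the head of a tape in the given direction, if any. -/
def moveHead {Γ : Type} [Inhabited Γ] (d : Option Turing.Dir) (T : Turing.Tape Γ) :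
    Turing.Tape Γ :=
  match d with
  | none => T
  | some d => T.move d

/-- One step of computation; `none` if the machine halts in `c`. The input head cannot move
beyond the end of the input. -/
def step (M : OnlineTM α) (c : M.Config) : Option M.Config :=
  (M.δ c.state c.rest.head? (fun i => (c.tape i).head)).map fun a =>
    { state := a.1
      rest := if a.2.1 then c.rest.tail else c.rest
      tape := fun i => moveHead (a.2.2 i).2 ((c.tape i).write (a.2.2 i).1) }

/-- The configuration after `s` steps on input `x` (constant once the machine has halted). -/
def configAt (M : OnlineTM α) (x : List α) (s : ℕ) : M.Config :=
  (fun c => (M.step c).getD c)^[s] (M.init x)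

/-- `M` decides `X` with at most `t n` steps between reading consecutive symbols of any input of
length `n`: on input `x` the machine halts, after `T` steps say, accepts iff `x ∈ X`, and during
these `T` steps the input head never rests on one position (one of the `n` input symbols, or the
end of the input) for more than `t n` steps. -/
def DecidesWithin (M : OnlineTM α) (X : Language α) (t : ℕ → ℝ) : Prop :=
  ∀ x : List α, ∃ T : ℕ,
    M.step (M.configAt x T) = none ∧
    ((M.configAt x T).state ∈ M.accepting ↔ x ∈ X) ∧
    ∀ a b : ℕ, a ≤ b → b ≤ T →
      (M.configAt x a).rest.length = (M.configAt x b).rest.length →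
      ((b - a : ℕ) : ℝ) ≤ t x.length

end OnlineTM

/-- The class `Online(t(n))`. -/
def Online (α : Type) (t : ℕ → ℝ) : Set (Language α) :=
  {X | ∃ M : OnlineTM α, M.DecidesWithin X t}

/-! ## Counting equivalence classes of prefixes -/

/-- Two words of length `l` are equivalent if no suffix of length `m` distinguishes them
with respect to `L`. -/
def prefixSetoid {α : Type} (L : Language α) (l m : ℕ) : Setoid (List.Vector α l) where
  r y₁ y₂ := ∀ x : List.Vector α m, y₁.toList ++ x.toList ∈ L ↔ y₂.toList ++ x.toList ∈ L
  iseqv :=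
    { refl := fun _ _ => Iff.rfl
      symm := fun h x => (h x).symm
      trans := fun h₁ h₂ x => (h₁ x).trans (h₂ x) }

/-- The number `E_L(l, m)` of equivalence classes. -/
noncomputable def numPrefixClasses {α : Type} (L : Language α) (l m : ℕ) : ℕ :=
  Nat.card (Quotient (prefixSetoid L l m))

/-- The alphabet `{0, 1, #}`. -/
inductive Letter : Type
  | zero
  | one
  | sharp

/-! The language `K` consists of the words `v₁#⋯#vₖ#u` in which `u` is the reversal of some `vᵢ`. A
PEG recognises it because recursion matches the letters of one block against the end of the word,
skipping the blocks in between, and ordered choice tries the blocks one after the other. A prefix of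
`K` can store an arbitrary set of binary words of length `D`, and a suffix of `D` digits queries
membership in it. The 2^(2^D) sets therefore give pairwise inequivalent prefixes
(`le_numPrefixClasses`). An online machine cannot tell that many prefixes apart. Once the prefix is
read, at most r = (D + 1)(⌊t(n)⌋ + 1) steps remain, so the verdict depends only on the state and on
the cells within distance r of the heads (`numPrefixClasses_le_card_view`), which allows 2^O(r)
possibilities (`exists_card_view_le`). For n = (D + 1)2^D + D, n/(log n)² is of order 2^D/D, so t(n)
= o(n/(log n)²) makes r = o(2^D) (`isLittleO_radius`), a contradiction. -/

instance : Finite Letter := by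
  refine Finite.of_surjective
    (fun i : Fin 3 => match i with
      | 0 => Letter.zero
      | 1 => Letter.one
      | 2 => Letter.sharp) ?_
  rintro (_ | _ | _)
  exacts [⟨0, rfl⟩, ⟨1, rfl⟩, ⟨2, rfl⟩]

/-! ## General facts about the recognition procedure -/

namespace PEG

/-- The recognition procedure has at most one result. -/
theorem Rec.unique {α : Type} {G : PEG α} {e : PExp α G.NT} {x : List α}
    {r r' : Option (List α)} (h : G.Rec e x r) (h' : G.Rec e x r') : r = r' := by
  induction h generalizing r' with
  | eps x => cases h'; rfl
  | fail x => cases h'; rfl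
  | term_hit a x z hx =>
    cases h' with
    | term_hit => rfl
    | term_miss _ _ hn => exact absurd ⟨z, hx⟩ hn
  | term_miss a x hn =>
    cases h' with
    | term_hit _ _ z hx => exact absurd ⟨z, hx⟩ hn
    | term_miss => rfl
  | not_of_fail e x _ ih =>
    cases h' with
    | not_of_fail => rfl
    | not_of_accept _ _ y hy => exact absurd (ih hy) (by simp)
  | not_of_accept e x y _ ih =>
    cases h' with
    | not_of_fail _ _ hy => exact absurd (ih hy) (by simp)
    | not_of_accept => rfl
  | and_of_accept e x y _ ih =>
    cases h' with
    | and_of_accept => rfl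
    | and_of_fail _ _ hy => exact absurd (ih hy) (by simp)
  | and_of_fail e x _ ih =>
    cases h' with
    | and_of_accept _ _ y hy => exact absurd (ih hy) (by simp)
    | and_of_fail => rfl
  | seq_accept e₁ e₂ x y₁ z y₂ _ hx _ ih₁ ih₂ =>
    cases h' with
    | seq_accept _ _ _ w₁ z' w₂ h₁ hx' h₂ =>
      obtain rfl := Option.some.inj (ih₁ h₁)
      obtain rfl := List.append_cancel_left (hx.symm.trans hx')
      obtain rfl := Option.some.inj (ih₂ h₂)
      rfl
    | seq_fail_left _ _ _ h₁ => exact absurd (ih₁ h₁) (by simp)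
    | seq_fail_right _ _ _ w₁ z' h₁ hx' h₂ =>
      obtain rfl := Option.some.inj (ih₁ h₁)
      obtain rfl := List.append_cancel_left (hx.symm.trans hx')
      exact absurd (ih₂ h₂) (by simp)
  | seq_fail_left e₁ e₂ x _ ih₁ =>
    cases h' with
    | seq_accept _ _ _ w₁ z' w₂ h₁ hx' h₂ => exact absurd (ih₁ h₁) (by simp)
    | seq_fail_left => rfl
    | seq_fail_right => rfl
  | seq_fail_right e₁ e₂ x y₁ z _ hx _ ih₁ ih₂ =>
    cases h' with
    | seq_accept _ _ _ w₁ z' w₂ h₁ hx' h₂ =>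
      obtain rfl := Option.some.inj (ih₁ h₁)
      obtain rfl := List.append_cancel_left (hx.symm.trans hx')
      exact absurd (ih₂ h₂) (by simp)
    | seq_fail_left => rfl
    | seq_fail_right => rfl
  | alt_left e₁ e₂ x y _ ih =>
    cases h' with
    | alt_left _ _ _ w hw => exact ih hw
    | alt_right _ _ _ _ hw => exact absurd (ih hw) (by simp)
  | alt_right e₁ e₂ x r _ _ ih₁ ih₂ =>
    cases h' with
    | alt_left _ _ _ w hw => exact absurd (ih₁ hw) (by simp)
    | alt_right _ _ _ _ _ hw => exact ih₂ hw
  | nonterm A x r _ ih =>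
    cases h' with
    | nonterm _ _ _ hw => exact ih hw

/-- What the recognition procedure consumes is a prefix of the input. -/
theorem Rec.isPrefix {α : Type} {G : PEG α} {e : PExp α G.NT} {x : List α}
    {r : Option (List α)} (h : G.Rec e x r) : ∀ y, r = some y → y <+: x := by
  induction h with
  | eps x => rintro _ ⟨⟩; exact List.nil_prefix
  | fail x => rintro _ ⟨⟩
  | term_hit a x z hx => rintro _ ⟨⟩; exact ⟨z, hx.symm⟩
  | term_miss => rintro _ ⟨⟩
  | not_of_fail => rintro _ ⟨⟩; exact List.nil_prefix
  | not_of_accept => rintro _ ⟨⟩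
  | and_of_accept => rintro _ ⟨⟩; exact List.nil_prefix
  | and_of_fail => rintro _ ⟨⟩
  | seq_accept e₁ e₂ x y₁ z y₂ _ hx _ _ ih₂ =>
    rintro _ ⟨⟩
    obtain ⟨w, rfl⟩ := ih₂ _ rfl
    exact ⟨w, by simp [hx]⟩
  | seq_fail_left => rintro _ ⟨⟩
  | seq_fail_right => rintro _ ⟨⟩
  | alt_left _ _ _ _ _ ih => exact ih
  | alt_right _ _ _ _ _ _ _ ih => exact ih
  | nonterm _ _ _ _ ih => exact ih

/-- A grammar is total as soon as the recognition procedure terminates on its non-terminals. -/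
theorem total_of_nonterm {α : Type} {G : PEG α}
    (h : ∀ (A : G.NT) (x : List α), ∃ r, G.Rec (.nonterm A) x r) : G.Total := by
  intro e
  induction e with
  | eps => exact fun x => ⟨_, .eps x⟩
  | fail => exact fun x => ⟨_, .fail x⟩
  | term a =>
    intro x
    by_cases hx : ∃ z, x = a :: z
    · exact ⟨_, .term_hit a x hx.choose hx.choose_spec⟩
    · exact ⟨_, .term_miss a x hx⟩
  | nonterm A => exact h A
  | notP e ih =>
    intro x
    obtain ⟨_ | y, hr⟩ := ih x
    · exact ⟨_, .not_of_fail _ _ hr⟩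
    · exact ⟨_, .not_of_accept _ _ _ hr⟩
  | andP e ih =>
    intro x
    obtain ⟨_ | y, hr⟩ := ih x
    · exact ⟨_, .and_of_fail _ _ hr⟩
    · exact ⟨_, .and_of_accept _ _ _ hr⟩
  | seq e₁ e₂ ih₁ ih₂ =>
    intro x
    obtain ⟨_ | y, hr⟩ := ih₁ x
    · exact ⟨_, .seq_fail_left _ _ _ hr⟩
    · obtain ⟨z, hz⟩ := hr.isPrefix _ rfl
      obtain ⟨_ | w, hw⟩ := ih₂ z
      · exact ⟨_, .seq_fail_right _ _ _ _ _ hr hz.symm hw⟩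
      · exact ⟨_, .seq_accept _ _ _ _ _ _ hr hz.symm hw⟩
  | alt e₁ e₂ ih₁ ih₂ =>
    intro x
    obtain ⟨_ | y, hr⟩ := ih₁ x
    · obtain ⟨r, hr'⟩ := ih₂ x
      exact ⟨_, .alt_right _ _ _ _ hr hr'⟩
    · exact ⟨_, .alt_left _ _ _ _ hr⟩

theorem Rec.term_ne {α : Type} {G : PEG α} {a b : α} (z : List α) (h : b ≠ a) :
    G.Rec (.term a) (b :: z) none :=
  .term_miss _ _ (by rintro ⟨w, hw⟩; exact h (List.cons.inj hw).1)

theorem Rec.term_nil {α : Type} {G : PEG α} (a : α) : G.Rec (.term a) [] none :=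
  .term_miss _ _ (by simp)

theorem Rec.term_cons {α : Type} {G : PEG α} (a : α) (z : List α) :
    G.Rec (.term a) (a :: z) (some [a]) :=
  .term_hit _ _ z rfl

end PEG

/-! ## The membership language

Its words are `v₁#v₂#⋯vₖ#u` with binary words `vᵢ` and `u`, such that `u` is the reversal of
some `vᵢ`. -/

namespace Membership

/-- The letter for a binary digit. -/
def digit : Bool → Letter
  | false => .zero
  | true => .one

/-- The word `v₁#v₂#⋯vₖ#u`. -/
def enc : List (List Bool) → List Bool → List Letter
  | [], u => u.map digit
  | v :: vs, u => v.map digit ++ .sharp :: enc vs u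

inductive NT
  | block
  | skip
  | palin
  | main

instance : Finite NT := by
  refine Finite.of_surjective
    (fun i : Fin 4 => match i with
      | 0 => NT.block
      | 1 => NT.skip
      | 2 => NT.palin
      | 3 => NT.main) ?_
  rintro (_ | _ | _ | _)
  exacts [⟨0, rfl⟩, ⟨1, rfl⟩, ⟨2, rfl⟩, ⟨3, rfl⟩]

/-- `block` consumes the digits up to the first `#`, and this `#`; `skip` consumes everything up to
the last `#`; `palin` consumes `v#⋯#` and then the reversal of `v`. -/
def grammar : PEG Letter where
  NT := NT
  finiteNT := inferInstance
  start := .main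
  rule
    | .block => .alt (.seq (.term .zero) (.nonterm .block))
        (.alt (.seq (.term .one) (.nonterm .block)) (.term .sharp))
    | .skip => .alt (.seq (.nonterm .block) (.nonterm .skip)) .eps
    | .palin => .alt (.seq (.term .zero) (.seq (.nonterm .palin) (.term .zero)))
        (.alt (.seq (.term .one) (.seq (.nonterm .palin) (.term .one)))
          (.seq (.term .sharp) (.nonterm .skip)))
    | .main => .alt
        (.seq (.nonterm .palin) (.notP (.alt (.term .zero) (.alt (.term .one) (.term .sharp)))))
        (.seq (.nonterm .block) (.nonterm .main))

/-- Cutting at every `#` covers all inputs, so totality reduces to words in block form. -/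
theorem exists_enc (x : List Letter) : ∃ vs u, x = enc vs u := by
  induction x with
  | nil => exact ⟨[], [], rfl⟩
  | cons a x ih =>
    obtain ⟨vs, u, rfl⟩ := ih
    have key : ∀ b, ∃ vs' u', digit b :: enc vs u = enc vs' u' := by
      intro b
      cases vs with
      | nil => exact ⟨[], b :: u, rfl⟩
      | cons v vs => exact ⟨(b :: v) :: vs, u, rfl⟩
    cases a with
    | zero => exact key false
    | one => exact key true
    | sharp => exact ⟨[] :: vs, u, rfl⟩

theorem enc_append (vs : List (List Bool)) (u w : List Bool) :
    enc vs (u ++ w) = enc vs u ++ w.map digit := by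
  induction vs with
  | nil => simp [enc]
  | cons v vs ih => simp [enc, ih]

theorem length_enc (vs : List (List Bool)) (u : List Bool) (d : ℕ)
    (h : ∀ v ∈ vs, v.length = d) : (enc vs u).length = (d + 1) * vs.length + u.length := by
  induction vs with
  | nil => simp [enc]
  | cons v vs ih =>
    have h₁ := h v (by simp)
    have h₂ := ih (fun w hw => h w (by simp [hw]))
    simp only [enc, List.length_append, List.length_map, List.length_cons, h₁, h₂]
    ring

/-! ### Results of the non-terminals on words in block form. -/

theorem rec_block (v : List Bool) (z : List Letter) :
    grammar.Rec (.nonterm NT.block) (v.map digit ++ .sharp :: z)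
      (some (v.map digit ++ [.sharp])) := by
  induction v with
  | nil =>
    exact .nonterm _ _ _ (.alt_right _ _ _ _ (.seq_fail_left _ _ _ (.term_ne _ (by simp)))
      (.alt_right _ _ _ _ (.seq_fail_left _ _ _ (.term_ne _ (by simp))) (.term_cons _ _)))
  | cons b v ih =>
    refine .nonterm _ _ _ ?_
    cases b with
    | false => exact .alt_left _ _ _ _ (.seq_accept _ _ _ [_] _ _ (.term_cons _ _) rfl ih)
    | true =>
      exact .alt_right _ _ _ _ (.seq_fail_left _ _ _ (.term_ne _ (by simp [digit])))
        (.alt_left _ _ _ _ (.seq_accept _ _ _ [_] _ _ (.term_cons _ _) rfl ih))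

/-- This failure ends the recursions of `skip` and `main` once the last `#` has been passed. -/
theorem rec_block_none (u : List Bool) :
    grammar.Rec (.nonterm NT.block) (u.map digit) none := by
  induction u with
  | nil =>
    exact .nonterm _ _ _ (.alt_right _ _ _ _ (.seq_fail_left _ _ _ (.term_nil _))
      (.alt_right _ _ _ _ (.seq_fail_left _ _ _ (.term_nil _)) (.term_nil _)))
  | cons b u ih =>
    refine .nonterm _ _ _ ?_
    cases b with
    | false =>
      exact .alt_right _ _ _ _ (.seq_fail_right _ _ _ [_] _ (.term_cons _ _) rfl ih)
        (.alt_right _ _ _ _ (.seq_fail_left _ _ _ (.term_ne _ (by simp [digit])))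
          (.term_ne _ (by simp [digit])))
    | true =>
      exact .alt_right _ _ _ _ (.seq_fail_left _ _ _ (.term_ne _ (by simp [digit])))
        (.alt_right _ _ _ _ (.seq_fail_right _ _ _ [_] _ (.term_cons _ _) rfl ih)
          (.term_ne _ (by simp [digit])))

theorem enc_cons_eq (v : List Bool) (vs : List (List Bool)) (u : List Bool) :
    enc (v :: vs) u = (v.map digit ++ [.sharp]) ++ enc vs u := by
  simp [enc]

theorem rec_skip (vs : List (List Bool)) (u : List Bool) :
    grammar.Rec (.nonterm NT.skip) (enc vs u) (some (enc vs [])) := by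
  induction vs with
  | nil =>
    exact .nonterm _ _ _ (.alt_right _ _ _ _ (.seq_fail_left _ _ _ (rec_block_none u)) (.eps _))
  | cons v vs ih =>
    rw [enc_cons_eq v vs []]
    exact .nonterm _ _ _ (.alt_left _ _ _ _
      (.seq_accept _ _ _ _ _ _ (rec_block v _) (enc_cons_eq v vs u) ih))

theorem rec_palin_none_of_digits (u : List Bool) :
    grammar.Rec (.nonterm NT.palin) (u.map digit) none := by
  induction u with
  | nil =>
    exact .nonterm _ _ _ (.alt_right _ _ _ _ (.seq_fail_left _ _ _ (.term_nil _))
      (.alt_right _ _ _ _ (.seq_fail_left _ _ _ (.term_nil _))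
        (.seq_fail_left _ _ _ (.term_nil _))))
  | cons b u ih =>
    refine .nonterm _ _ _ ?_
    cases b with
    | false =>
      exact .alt_right _ _ _ _
        (.seq_fail_right _ _ _ [_] _ (.term_cons _ _) rfl (.seq_fail_left _ _ _ ih))
        (.alt_right _ _ _ _ (.seq_fail_left _ _ _ (.term_ne _ (by simp [digit])))
          (.seq_fail_left _ _ _ (.term_ne _ (by simp [digit]))))
    | true =>
      exact .alt_right _ _ _ _ (.seq_fail_left _ _ _ (.term_ne _ (by simp [digit])))
        (.alt_right _ _ _ _
          (.seq_fail_right _ _ _ [_] _ (.term_cons _ _) rfl (.seq_fail_left _ _ _ ih))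
          (.seq_fail_left _ _ _ (.term_ne _ (by simp [digit]))))

/-- After a digit `b`, the expression for `palin` does what `palin b` does on the rest. -/
theorem rec_palin_cons (b : Bool) (x : List Letter) (r : Option (List Letter))
    (h : grammar.Rec (.seq (.nonterm NT.palin) (.term (digit b))) x r) :
    grammar.Rec (.nonterm NT.palin) (digit b :: x) (r.map (digit b :: ·)) := by
  refine .nonterm _ _ _ ?_
  cases b with
  | false =>
    cases r with
    | some y => exact .alt_left _ _ _ _ (.seq_accept _ _ _ [_] _ _ (.term_cons _ _) rfl h)
    | none =>
      exact .alt_right _ _ _ _ (.seq_fail_right _ _ _ [_] _ (.term_cons _ _) rfl h)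
        (.alt_right _ _ _ _ (.seq_fail_left _ _ _ (.term_ne _ (by simp [digit])))
          (.seq_fail_left _ _ _ (.term_ne _ (by simp [digit]))))
  | true =>
    refine .alt_right _ _ _ _ (.seq_fail_left _ _ _ (.term_ne _ (by simp [digit]))) ?_
    cases r with
    | some y => exact .alt_left _ _ _ _ (.seq_accept _ _ _ [_] _ _ (.term_cons _ _) rfl h)
    | none =>
      exact .alt_right _ _ _ _ (.seq_fail_right _ _ _ [_] _ (.term_cons _ _) rfl h)
        (.seq_fail_left _ _ _ (.term_ne _ (by simp [digit])))

theorem digit_injective : Function.Injective digit := by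
  rintro (_ | _) (_ | _) h <;> simp_all [digit]

/-- The tail `w` varies in the induction: for a block `b :: v`, the inner call sees `b :: w` after
the reversal of `v`, and that `b` is the letter the outer call then consumes. -/
theorem rec_palin_some (v : List Bool) (vs : List (List Bool)) (w : List Bool) :
    grammar.Rec (.nonterm NT.palin) (enc (v :: vs) (v.reverse ++ w))
      (some (enc (v :: vs) v.reverse)) := by
  induction v generalizing w with
  | nil =>
    refine .nonterm _ _ _ (.alt_right _ _ _ _ (.seq_fail_left _ _ _ (.term_ne _ (by simp)))
      (.alt_right _ _ _ _ (.seq_fail_left _ _ _ (.term_ne _ (by simp))) ?_))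
    exact .seq_accept _ _ _ [_] _ _ (.term_cons _ _) rfl (rec_skip vs w)
  | cons b v ih =>
    have h := ih (b :: w)
    rw [enc_append (v :: vs)] at h
    have h' := rec_palin_cons b _ _
      (.seq_accept _ _ _ _ _ _ h rfl (PEG.Rec.term_cons (digit b) (w.map digit)))
    convert h' using 1
    · simp [enc, enc_append]
    · simp [enc, enc_append]

/-- Either the inner call fails already, or it matches and the next letter is missing or wrong. Only
prefixes are compared, because `palin` never tests for the end of the input. -/
theorem rec_palin_none (v : List Bool) (vs : List (List Bool)) (u : List Bool)
    (hu : ¬ v.reverse <+: u) : grammar.Rec (.nonterm NT.palin) (enc (v :: vs) u) none := by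
  induction v with
  | nil => exact absurd List.nil_prefix hu
  | cons b v ih =>
    refine rec_palin_cons b (enc (v :: vs) u) none ?_
    by_cases hv : v.reverse <+: u
    · obtain ⟨w, rfl⟩ := hv
      refine .seq_fail_right _ _ _ _ _ (rec_palin_some v vs w) (enc_append (v :: vs) _ w) ?_
      cases w with
      | nil => exact .term_nil _
      | cons c w =>
        refine .term_ne _ fun hc => hu ⟨w, ?_⟩
        rw [digit_injective hc]
        simp
    · exact .seq_fail_left _ _ _ (ih hv)

/-- The `notP` factor turns the prefix match of `palin` into a match with all of `u`; if that fails,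
the second alternative drops the first block and retries. The failure half serves totality and, by
uniqueness of results, the converse direction in `enc_mem_language`. -/
theorem rec_main (vs : List (List Bool)) (u : List Bool) :
    ((∃ v ∈ vs, v.reverse = u) →
      grammar.Rec (.nonterm NT.main) (enc vs u) (some (enc vs u))) ∧
    ((¬ ∃ v ∈ vs, v.reverse = u) → grammar.Rec (.nonterm NT.main) (enc vs u) none) := by
  induction vs with
  | nil =>
    refine ⟨by simp, fun _ => ?_⟩
    exact .nonterm _ _ _ (.alt_right _ _ _ _
      (.seq_fail_left _ _ _ (rec_palin_none_of_digits u))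
      (.seq_fail_left _ _ _ (rec_block_none u)))
  | cons v vs ih =>
    by_cases hv : v.reverse = u
    · refine ⟨fun _ => ?_, fun h => absurd ⟨v, by simp, hv⟩ h⟩
      subst hv
      have h := rec_palin_some v vs []
      rw [List.append_nil] at h
      have h' := PEG.Rec.seq_accept _ _ _ _ [] _ h (by simp)
        (.not_of_fail _ _ (.alt_right _ _ _ _ (.term_nil Letter.zero)
          (.alt_right _ _ _ _ (.term_nil Letter.one) (.term_nil Letter.sharp))))
      rw [List.append_nil] at h'
      exact .nonterm _ _ _ (.alt_left _ _ _ _ h')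
    · have hfail : grammar.Rec (.seq (.nonterm NT.palin)
          (.notP (.alt (.term .zero) (.alt (.term .one) (.term .sharp)))))
          (enc (v :: vs) u) none := by
        by_cases hp : v.reverse <+: u
        · obtain ⟨w, rfl⟩ := hp
          refine .seq_fail_right _ _ _ _ _ (rec_palin_some v vs w) (enc_append (v :: vs) _ w) ?_
          cases w with
          | nil => simp at hv
          | cons c w =>
            cases c with
            | false => exact .not_of_accept _ _ _ (.alt_left _ _ _ _ (.term_cons _ _))
            | true =>
              exact .not_of_accept _ _ _ (.alt_right _ _ _ _ (.term_ne _ (by simp [digit]))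
                (.alt_left _ _ _ _ (.term_cons _ _)))
        · exact .seq_fail_left _ _ _ (rec_palin_none v vs u hp)
      simp only [List.mem_cons, exists_eq_or_imp, hv, false_or]
      refine ⟨fun h => ?_, fun h => ?_⟩
      · refine .nonterm _ _ _ (.alt_right _ _ _ _ hfail ?_)
        have h' := PEG.Rec.seq_accept _ _ _ _ _ _ (rec_block v (enc vs u)) (enc_cons_eq v vs u)
          (ih.1 h)
        rwa [← enc_cons_eq] at h'
      · exact .nonterm _ _ _ (.alt_right _ _ _ _ hfail
          (.seq_fail_right _ _ _ _ _ (rec_block v _) (enc_cons_eq v vs u) (ih.2 h)))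

theorem grammar_total : grammar.Total := by
  refine PEG.total_of_nonterm fun A x => ?_
  obtain ⟨vs, u, rfl⟩ := exists_enc x
  match A with
  | NT.block =>
    cases vs with
    | nil => exact ⟨_, rec_block_none u⟩
    | cons v vs => exact ⟨_, rec_block v _⟩
  | NT.skip => exact ⟨_, rec_skip vs u⟩
  | NT.palin =>
    cases vs with
    | nil => exact ⟨_, rec_palin_none_of_digits u⟩
    | cons v vs =>
      by_cases hp : v.reverse <+: u
      · obtain ⟨w, rfl⟩ := hp
        exact ⟨_, rec_palin_some v vs w⟩
      · exact ⟨_, rec_palin_none v vs u hp⟩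
  | NT.main =>
    by_cases h : ∃ v ∈ vs, v.reverse = u
    · exact ⟨_, (rec_main vs u).1 h⟩
    · exact ⟨_, (rec_main vs u).2 h⟩

theorem enc_mem_language (vs : List (List Bool)) (u : List Bool) :
    enc vs u ∈ grammar.language ↔ ∃ v ∈ vs, v.reverse = u := by
  refine ⟨fun h => ?_, (rec_main vs u).1⟩
  by_contra hn
  exact absurd (PEG.Rec.unique h ((rec_main vs u).2 hn)) (by simp)

/-! ### Lower bound on the number of prefix classes. -/

/-- Every set of binary words of length `D` is the set of binary words of this length that
complete some prefix of length `(D + 1) * 2 ^ D`. -/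
theorem exists_prefix (D : ℕ) (S : Set (List.Vector Bool D)) :
    ∃ y : List.Vector Letter ((D + 1) * 2 ^ D), ∀ w : List.Vector Bool D,
      y.toList ++ w.toList.map digit ∈ grammar.language ↔ w ∈ S := by
  classical
  rcases S.eq_empty_or_nonempty with rfl | ⟨w₀, hw₀⟩
  -- A prefix without `#` contains no block, so no digit suffix completes it.
  · refine ⟨⟨enc [] (List.replicate ((D + 1) * 2 ^ D) false), by simp [enc]⟩, fun w => ?_⟩
    rw [List.Vector.toList_mk, ← enc_append, enc_mem_language]
    simp
  -- Words outside `S` are replaced by the fixed `w₀ ∈ S`, so that there are exactly 2^D blocks of D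
  -- + 1 letters, `#` included, whatever the size of `S`.
  · let f : List.Vector Bool D → List Bool := fun v =>
      if v ∈ S then v.toList.reverse else w₀.toList.reverse
    refine ⟨⟨enc (Finset.univ.toList.map f) [], ?_⟩, fun w => ?_⟩
    · rw [length_enc _ _ D]
      · simp
      · intro v hv
        obtain ⟨u, -, rfl⟩ := List.mem_map.1 hv
        by_cases hu : u ∈ S <;> simp [f, hu]
    · rw [List.Vector.toList_mk, ← enc_append, enc_mem_language]
      simp only [List.mem_map, Finset.mem_toList, Finset.mem_univ, true_and, List.nil_append]
      constructor
      · rintro ⟨_, ⟨v, rfl⟩, hv⟩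
        by_cases hvS : v ∈ S
        · simp only [f, hvS, if_true, List.reverse_reverse] at hv
          rwa [← List.Vector.toList_injective hv]
        · simp only [f, hvS, if_false, List.reverse_reverse] at hv
          rwa [← List.Vector.toList_injective hv]
      · exact fun hw => ⟨_, ⟨w, rfl⟩, by simp [f, hw]⟩

theorem le_numPrefixClasses (D : ℕ) :
    2 ^ 2 ^ D ≤ numPrefixClasses grammar.language ((D + 1) * 2 ^ D) D := by
  -- Needed because `Nat.card` of an infinite type is 0, so injectivity alone would give no bound.
  have hfin : Finite (List.Vector Letter ((D + 1) * 2 ^ D)) := by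
    have := Fintype.ofFinite Letter
    infer_instance
  choose y hy using exists_prefix D
  have hcard : Nat.card (Set (List.Vector Bool D)) = 2 ^ 2 ^ D := by
    classical
    simp [Nat.card_eq_fintype_card]
  rw [← hcard]
  refine Nat.card_le_card_of_injective
    (fun S => (Quotient.mk (prefixSetoid grammar.language _ D) (y S))) ?_
  intro S S' h
  have h' := Quotient.exact h
  ext w
  rw [← hy S w, ← hy S' w]
  exact h' ⟨w.toList.map digit, by simp⟩

end Membership
/-! ## Online Turing machines with few steps per input symbol distinguish few prefixes -/

instance (Γ : Type) [Finite Γ] : Finite (TapeSymbol Γ) := by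
  refine Finite.of_injective
    (fun s : TapeSymbol Γ => match s with
      | .blank => (none : Option (Bool ⊕ Γ))
      | .bit b => some (.inl b)
      | .sym g => some (.inr g)) ?_
  rintro (_ | _ | _) (_ | _ | _) h <;> simp_all

namespace OnlineTM

variable {α : Type}

/-! ### Locality: a short computation sees only cells near the heads. -/

/-- Two tapes have the same symbols at distance at most `r` from their heads. -/
def AgreeWithin {Γ : Type} [Inhabited Γ] (r : ℕ) (T T' : Turing.Tape Γ) : Prop :=
  ∀ i : ℤ, |i| ≤ r → T.nth i = T'.nth i

theorem AgreeWithin.mono {Γ : Type} [Inhabited Γ] {r s : ℕ} (hrs : r ≤ s)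
    {T T' : Turing.Tape Γ} (h : AgreeWithin s T T') : AgreeWithin r T T' :=
  fun i hi => h i (by omega)

theorem AgreeWithin.head_eq {Γ : Type} [Inhabited Γ] {r : ℕ}
    {T T' : Turing.Tape Γ} (h : AgreeWithin r T T') : T.head = T'.head := by
  have := h 0 (by simp)
  simpa using this

theorem AgreeWithin.moveHead_write {Γ : Type} [Inhabited Γ] {r : ℕ} {T T' : Turing.Tape Γ}
    (h : AgreeWithin (r + 1) T T') (d : Option Turing.Dir) (a : Γ) :
    AgreeWithin r (moveHead d (T.write a)) (moveHead d (T'.write a)) := by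
  have hw : AgreeWithin (r + 1) (T.write a) (T'.write a) := by
    intro i hi
    rw [Turing.Tape.write_nth, Turing.Tape.write_nth, h i hi]
  intro i hi
  rw [abs_le] at hi
  match d with
  | none => exact hw i (abs_le.2 (by omega))
  | some .left =>
    simp only [moveHead, Turing.Tape.move_left_nth]
    exact hw _ (abs_le.2 (by push_cast; omega))
  | some .right =>
    simp only [moveHead, Turing.Tape.move_right_nth]
    exact hw _ (abs_le.2 (by push_cast; omega))

/-- One step of computation, where halted configurations stay as they are. -/
def next (M : OnlineTM α) (c : M.Config) : M.Config := (M.step c).getD c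

theorem configAt_add (M : OnlineTM α) (x : List α) (s j : ℕ) :
    M.configAt x (s + j) = M.next^[j] (M.configAt x s) := by
  rw [add_comm]
  exact Function.iterate_add_apply M.next j s _

theorem configAt_succ (M : OnlineTM α) (x : List α) (s : ℕ) :
    M.configAt x (s + 1) = M.next (M.configAt x s) :=
  M.configAt_add x s 1

theorem next_eq_self {M : OnlineTM α} {c : M.Config} (h : M.step c = none) : M.next c = c := by
  simp [next, h]

theorem configAt_eq_of_halted {M : OnlineTM α} {x : List α} {s j : ℕ} (hsj : s ≤ j)
    (h : M.step (M.configAt x s) = none) : M.configAt x j = M.configAt x s := by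
  obtain ⟨i, rfl⟩ := Nat.exists_eq_add_of_le hsj
  rw [configAt_add]
  exact Function.iterate_fixed (next_eq_self h) i

theorem configAt_eq_of_halted_of_halted {M : OnlineTM α} {x : List α} {s j : ℕ}
    (h : M.step (M.configAt x s) = none) (h' : M.step (M.configAt x j) = none) :
    M.configAt x s = M.configAt x j := by
  rcases le_total s j with hsj | hsj
  · exact (configAt_eq_of_halted hsj h).symm
  · exact configAt_eq_of_halted hsj h'

/-- Two configurations that only differ on the tapes, at distance more than `r` from the heads. -/
structure Sim (M : OnlineTM α) (r : ℕ) (c c' : M.Config) : Prop where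
  state_eq : c.state = c'.state
  rest_eq : c.rest = c'.rest
  agree : ∀ i, AgreeWithin r (c.tape i) (c'.tape i)

theorem Sim.transition_eq {M : OnlineTM α} {r : ℕ} {c c' : M.Config} (h : M.Sim r c c') :
    M.δ c.state c.rest.head? (fun i => (c.tape i).head) =
      M.δ c'.state c'.rest.head? (fun i => (c'.tape i).head) := by
  rw [h.state_eq, h.rest_eq, funext fun i => (h.agree i).head_eq]

theorem Sim.step_eq_none_iff {M : OnlineTM α} {r : ℕ} {c c' : M.Config} (h : M.Sim r c c') :
    M.step c = none ↔ M.step c' = none := by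
  simp only [step, Option.map_eq_none_iff, h.transition_eq]

/-- The transition reads only the scanned cells, so both configurations make the same move; each
head shifts by at most one cell, which costs one unit of radius. -/
theorem Sim.next {M : OnlineTM α} {r : ℕ} {c c' : M.Config} (h : M.Sim (r + 1) c c') :
    M.Sim r (M.next c) (M.next c') := by
  have hδ := h.transition_eq
  unfold OnlineTM.next step
  rw [hδ]
  cases M.δ c'.state c'.rest.head? (fun i => (c'.tape i).head) with
  | none => exact ⟨h.state_eq, h.rest_eq, fun i => (h.agree i).mono (Nat.le_succ r)⟩
  | some a =>
    refine ⟨rfl, ?_, fun i => (h.agree i).moveHead_write _ _⟩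
    simp [h.rest_eq]

theorem Sim.iterate_next {M : OnlineTM α} {r j : ℕ} {c c' : M.Config} (h : M.Sim (r + j) c c') :
    M.Sim r (M.next^[j] c) (M.next^[j] c') := by
  induction j generalizing c c' with
  | zero => exact h
  | succ j ih => exact ih (Sim.next h)

theorem length_rest_antitone (M : OnlineTM α) (x : List α) :
    Antitone fun s => (M.configAt x s).rest.length := by
  refine antitone_nat_of_succ_le fun s => ?_
  rw [configAt_succ]
  unfold next step
  cases M.δ _ _ _ with
  | none => exact le_rfl
  | some a =>
    by_cases ha : a.2.1 <;> simp [ha]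

/-- An antitone sequence that rests on no value for more than `τ` steps takes at most
`(d + 1) * (τ + 1)` steps after it is down at `d`. -/
theorem le_add_of_rest_le {f : ℕ → ℕ} (hf : Antitone f) {T τ : ℕ}
    (h : ∀ a b, a ≤ b → b ≤ T → f a = f b → b - a ≤ τ) {d s : ℕ} (hs : f s ≤ d) :
    T ≤ s + (d + 1) * (τ + 1) := by
  induction d generalizing s with
  | zero =>
    rcases le_total T s with hT | hT
    · omega
    · have := h s T hT le_rfl (by have := hf hT; omega)
      omega
  | succ d ih =>
    -- If τ + 1 further steps fit before `T`, then `f` must drop during them and the induction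
    -- hypothesis applies at value `d`.
    by_cases hT : s + (τ + 1) ≤ T
    · have hle := hf (show s ≤ s + (τ + 1) by omega)
      have hne : f s ≠ f (s + (τ + 1)) := fun he => by
        have := h s _ (by omega) hT he
        omega
      have := ih (s := s + (τ + 1)) (by omega)
      linarith
    · have : τ + 1 ≤ (d + 1 + 1) * (τ + 1) := Nat.le_mul_of_pos_left _ (by omega)
      omega

/-- There is a time at which the machine has either read exactly `y` or halted before, and up to
which the remaining input `x` plays no role. -/
theorem exists_config_after_prefix (M : OnlineTM α) (y : List α) (m : ℕ)
    (hhalt : ∀ z : List α, ∃ T, M.step (M.configAt z T) = none) :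
    ∃ (s : ℕ) (q : M.Q) (u : List α) (tape : Fin (M.k + 1) → Turing.Tape (TapeSymbol M.Γ)),
      (∀ x : List α, x.length = m → M.configAt (y ++ x) s = ⟨q, u ++ x, tape⟩) ∧
      (u = [] ∨ ∀ x : List α, M.step ⟨q, u ++ x, tape⟩ = none) := by
  by_contra hcon
  -- While some of the prefix is left, the scanned letter comes from `u`, so a step ignores `x`.
  have hstep : ∀ q u tape, u ≠ [] → ∀ x, M.step ⟨q, u ++ x, tape⟩ =
      (M.δ q u.head? (fun i => (tape i).head)).map fun a =>
        ⟨a.1, (if a.2.1 then u.tail else u) ++ x,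
          fun i => moveHead (a.2.2 i).2 ((tape i).write (a.2.2 i).1)⟩ := by
    intro q u tape hu x
    cases u with
    | nil => exact absurd rfl hu
    | cons b u =>
      simp only [step, List.cons_append, List.head?_cons, List.tail_cons]
      congr 1
      funext a
      by_cases ha : a.2.1 <;> simp [ha]
  -- If no such time existed, the machine would stay inside the prefix without ever halting.
  have key : ∀ s : ℕ, ∃ q u tape, u ≠ [] ∧
      ∀ x : List α, x.length = m → M.configAt (y ++ x) s = ⟨q, u ++ x, tape⟩ := by
    intro s
    induction s with
    | zero =>
      -- The auxiliary tape depends on the input length, which is why the length of `x` is fixed.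
      have h₀ : ∀ x : List α, x.length = m → M.configAt (y ++ x) 0 =
          ⟨M.start, y ++ x, fun i => if i = 0 then
            Turing.Tape.mk₁ ((binaryDigits (y.length + m)).map TapeSymbol.bit)
            else Turing.Tape.mk₁ []⟩ := by
        rintro x rfl
        simp [configAt, init]
      exact ⟨_, _, _, fun hy => hcon ⟨_, _, _, _, h₀, .inl hy⟩, h₀⟩
    | succ s ih =>
      obtain ⟨q, u, tape, hu, h⟩ := ih
      cases ha : M.δ q u.head? (fun i => (tape i).head) with
      | none =>
        exact absurd ⟨s, q, u, tape, h, .inr fun x => by rw [hstep q u tape hu, ha]; rfl⟩ hcon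
      | some a =>
        have h' : ∀ x : List α, x.length = m → M.configAt (y ++ x) (s + 1) =
            ⟨a.1, (if a.2.1 then u.tail else u) ++ x,
              fun i => moveHead (a.2.2 i).2 ((tape i).write (a.2.2 i).1)⟩ := by
          intro x hx
          rw [configAt_succ, h x hx, next, hstep q u tape hu, ha]
          rfl
        exact ⟨_, _, _, fun hn => hcon ⟨_, _, _, _, h', .inl hn⟩, h'⟩
  -- The alphabet might be empty; a nonempty `u` supplies a letter.
  have hx : ∃ x : List α, x.length = m := by
    obtain ⟨_, u, _, hu, -⟩ := key 0
    exact ⟨List.replicate m (u.head hu), by simp⟩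
  obtain ⟨x, hx⟩ := hx
  obtain ⟨T, hT⟩ := hhalt (y ++ x)
  obtain ⟨q, u, tape, hu, h⟩ := key T
  refine hcon ⟨T, q, u, tape, h, .inr fun x' => ?_⟩
  rw [h x hx, hstep q u tape hu, Option.map_eq_none_iff] at hT
  rw [hstep q u tape hu, hT]
  rfl

/-- The state, whether the prefix has been read completely, and the symbols at distance at most
`r` from the heads. -/
abbrev View (M : OnlineTM α) (r : ℕ) : Type :=
  M.Q × Bool × (Fin (M.k + 1) → Fin (2 * r + 1) → TapeSymbol M.Γ)

/-- After the prefix the input head has `m + 1` positions left, counting the end of the input, and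
each accounts for at most ⌊t⌋ + 1 steps. Equal views thus force equal verdicts, each run being
followed from its own time `s y`. If the machine halts before finishing the prefix, the state alone
decides. -/
theorem numPrefixClasses_le_card_view {M : OnlineTM α} {X : Language α} {t : ℕ → ℝ}
    (hM : M.DecidesWithin X t) (l m : ℕ) :
    numPrefixClasses X l m ≤ Nat.card (M.View ((m + 1) * (⌊t (l + m)⌋₊ + 1))) := by
  classical
  have := M.finiteQ
  have := M.finiteΓ
  set r := (m + 1) * (⌊t (l + m)⌋₊ + 1) with hr
  choose s q u tape hconf hu using fun y : List.Vector α l =>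
    M.exists_config_after_prefix y.toList m fun z => (hM z).imp fun T h => h.1
  let view : List.Vector α l → M.View r := fun y =>
    (q y, decide (u y = []), fun i j => (tape y i).nth ((j : ℤ) - r))
  have hview : ∀ y y', view y = view y' → (prefixSetoid X l m).r y y' := by
    intro y y' h x
    obtain ⟨T, hT, hacc, htime⟩ := hM (y.toList ++ x.toList)
    obtain ⟨T', hT', hacc', -⟩ := hM (y'.toList ++ x.toList)
    rw [← hacc, ← hacc']
    have hq : q y = q y' := congrArg Prod.fst h
    have hd : (u y = []) ↔ (u y' = []) := by
      have := congrArg (fun v : M.View r => v.2.1) h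
      simpa [view] using this
    have hc := hconf y x.toList x.toList_length
    have hc' := hconf y' x.toList x.toList_length
    suffices hst : (M.configAt (y.toList ++ x.toList) T).state =
        (M.configAt (y'.toList ++ x.toList) T').state by rw [hst]
    by_cases hn : u y = []
    · have hn' := hd.1 hn
      rw [hn, List.nil_append] at hc
      rw [hn', List.nil_append] at hc'
      have hsim : M.Sim r (M.configAt (y.toList ++ x.toList) (s y))
          (M.configAt (y'.toList ++ x.toList) (s y')) := by
        rw [hc, hc']
        refine ⟨hq, rfl, fun i j hj => ?_⟩
        rw [abs_le] at hj
        have := congrFun (congrFun (congrArg (fun v : M.View r => v.2.2) h) i)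
          ⟨(j + r).toNat, by omega⟩
        have hj' : (((j + r).toNat : ℕ) : ℤ) - r = j := by omega
        simpa only [view, hj'] using this
      have hT_le : T ≤ s y + r := by
        rw [hr]
        refine le_add_of_rest_le (M.length_rest_antitone (y.toList ++ x.toList))
          (fun a b hab hb hrest => ?_) (by simp [hc])
        have := htime a b hab hb hrest
        rw [List.length_append, y.toList_length, x.toList_length] at this
        exact Nat.le_floor this
      -- Truncated subtraction covers a machine that has halted by time `s y`: in every case `s y +
      -- (T - s y) ≥ T`, where the configuration no longer changes.
      have hsim' : M.Sim (r - (T - s y)) (M.configAt (y.toList ++ x.toList) (s y + (T - s y)))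
          (M.configAt (y'.toList ++ x.toList) (s y' + (T - s y))) := by
        rw [configAt_add, configAt_add]
        refine Sim.iterate_next ?_
        rwa [Nat.sub_add_cancel (by omega)]
      have heq := configAt_eq_of_halted (j := s y + (T - s y)) (by omega) hT
      rw [heq] at hsim'
      rw [hsim'.state_eq]
      rw [configAt_eq_of_halted_of_halted (hsim'.step_eq_none_iff.1 hT) hT']
    · have hn' := fun e => hn (hd.2 e)
      have hh := (hu y).resolve_left hn x.toList
      have hh' := (hu y').resolve_left hn' x.toList
      rw [← hc] at hh
      rw [← hc'] at hh'
      rw [configAt_eq_of_halted_of_halted hT hh, configAt_eq_of_halted_of_halted hT' hh', hc, hc']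
      exact hq
  refine Nat.card_le_card_of_injective
    (fun e : Quotient (prefixSetoid X l m) => view e.out) fun e e' h => ?_
  rw [← Quotient.out_eq e, ← Quotient.out_eq e']
  exact Quotient.sound (hview _ _ h)

theorem exists_card_view_le (M : OnlineTM α) :
    ∃ C : ℕ, ∀ r : ℕ, Nat.card (M.View r) ≤ 2 ^ (C * (r + 1)) := by
  have := M.finiteQ
  have := M.finiteΓ
  set a := Nat.card M.Q
  set g := Nat.card (TapeSymbol M.Γ)
  -- With `a ≤ 2 ^ a` and `g ≤ 2 ^ g`, the exponent gets `a` from the state, 1 from the flag, and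
  -- `g` from each of the `(2 * r + 1) * (k + 1)` visible cells.
  refine ⟨a + 1 + 2 * g * (M.k + 1), fun r => ?_⟩
  have hcard : Nat.card (M.View r) = a * (2 * (g ^ (2 * r + 1)) ^ (M.k + 1)) := by
    simp [View, Nat.card_prod, Nat.card_fun, a, g]
  have ha : a ≤ 2 ^ a := Nat.lt_two_pow_self.le
  have hg : g ≤ 2 ^ g := Nat.lt_two_pow_self.le
  calc Nat.card (M.View r) = a * (2 * (g ^ (2 * r + 1)) ^ (M.k + 1)) := hcard
    _ ≤ 2 ^ a * (2 * ((2 ^ g) ^ (2 * r + 1)) ^ (M.k + 1)) := by gcongr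
    _ = 2 ^ (a + 1 + g * (2 * r + 1) * (M.k + 1)) := by
        rw [← pow_mul, ← pow_mul]
        ring
    _ ≤ 2 ^ ((a + 1 + 2 * g * (M.k + 1)) * (r + 1)) := by
        refine Nat.pow_le_pow_right (by norm_num) ?_
        have h₁ : a + 1 ≤ (a + 1) * (r + 1) := Nat.le_mul_of_pos_right _ (by omega)
        have h₂ : g * (2 * r + 1) * (M.k + 1) ≤ 2 * g * (M.k + 1) * (r + 1) := by
          calc g * (2 * r + 1) * (M.k + 1) ≤ g * (2 * r + 2) * (M.k + 1) := by gcongr; norm_num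
            _ = 2 * g * (M.k + 1) * (r + 1) := by ring
        linarith

end OnlineTM

/-! ## Asymptotics -/

open Asymptotics Filter in
-- At n = (D + 1)2^D + D one has n ≤ 2(D + 1)2^D and log n ≥ D log 2, so n/(log n)² = O(2^D/(D +
-- 1)), and the factor D + 1 in the radius cancels the denominator.
theorem isLittleO_radius {t : ℕ → ℝ}
    (ht : t =o[atTop] (fun n : ℕ => (n : ℝ) / Real.log (n : ℝ) ^ 2)) :
    (fun D : ℕ => ((D + 1 : ℕ) : ℝ) * (⌊t ((D + 1) * 2 ^ D + D)⌋₊ + 1)) =o[atTop]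
      (fun D : ℕ => (2 : ℝ) ^ D) := by
  have hn : Tendsto (fun D : ℕ => (D + 1) * 2 ^ D + D) atTop atTop :=
    tendsto_atTop_mono (fun D => Nat.le_add_left _ _) tendsto_id
  have hO : (fun D : ℕ => (((D + 1) * 2 ^ D + D : ℕ) : ℝ) /
      Real.log (((D + 1) * 2 ^ D + D : ℕ) : ℝ) ^ 2) =O[atTop]
      (fun D : ℕ => (2 : ℝ) ^ D / (D + 1 : ℕ)) := by
    refine IsBigO.of_bound (8 / Real.log 2 ^ 2) ?_
    -- The bound (D + 1)/2 ≤ D used for the logarithm fails at D = 0.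
    filter_upwards [eventually_ge_atTop 1] with D hD
    have hlog2 : 0 < Real.log 2 := Real.log_pos (by norm_num)
    have hD1 : (1 : ℝ) ≤ D := by exact_mod_cast hD
    have hpow : (1 : ℝ) ≤ 2 ^ D := one_le_pow₀ (by norm_num)
    have hlog : ((D : ℝ) + 1) / 2 * Real.log 2 ≤ Real.log (((D + 1) * 2 ^ D + D : ℕ) : ℝ) := by
      calc ((D : ℝ) + 1) / 2 * Real.log 2 ≤ D * Real.log 2 := by gcongr; linarith
        _ = Real.log (2 ^ D) := by rw [Real.log_pow]
        _ ≤ _ := by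
          refine Real.log_le_log (by positivity) ?_
          push_cast
          nlinarith
    have hnum : (((D + 1) * 2 ^ D + D : ℕ) : ℝ) ≤ 2 * ((D + 1) * 2 ^ D) := by
      push_cast
      nlinarith
    rw [Real.norm_of_nonneg (by positivity), Real.norm_of_nonneg (by positivity)]
    calc (((D + 1) * 2 ^ D + D : ℕ) : ℝ) / Real.log (((D + 1) * 2 ^ D + D : ℕ) : ℝ) ^ 2
        ≤ (2 * ((D + 1) * 2 ^ D)) / (((D : ℝ) + 1) / 2 * Real.log 2) ^ 2 := by gcongr
      _ = 8 / Real.log 2 ^ 2 * (2 ^ D / (D + 1 : ℕ)) := by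
        push_cast
        field_simp
        ring
  have ht' : (fun D : ℕ => t ((D + 1) * 2 ^ D + D)) =o[atTop]
      (fun D : ℕ => (2 : ℝ) ^ D / (D + 1 : ℕ)) := (ht.comp_tendsto hn).trans_isBigO hO
  have hfloor : (fun D : ℕ => ((⌊t ((D + 1) * 2 ^ D + D)⌋₊ : ℕ) : ℝ)) =o[atTop]
      (fun D : ℕ => (2 : ℝ) ^ D / (D + 1 : ℕ)) := by
    refine IsBigO.trans_isLittleO (IsBigO.of_bound 1 (Eventually.of_forall fun D => ?_)) ht'
    rw [one_mul, Real.norm_of_nonneg (Nat.cast_nonneg _)]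
    -- `t` may be negative, in which case the natural floor is 0.
    rcases le_total 0 (t ((D + 1) * 2 ^ D + D)) with h | h
    · exact (Nat.floor_le h).trans (le_abs_self _)
    · simp [Nat.floor_of_nonpos h]
  have h₁ : (fun D : ℕ => ((D + 1 : ℕ) : ℝ) * (⌊t ((D + 1) * 2 ^ D + D)⌋₊ : ℕ)) =o[atTop]
      (fun D : ℕ => (2 : ℝ) ^ D) := by
    refine ((isBigO_refl (fun D : ℕ => ((D + 1 : ℕ) : ℝ)) atTop).mul_isLittleO hfloor).congr_right
      fun D => ?_
    field_simp
  have h₂ : (fun D : ℕ => ((D + 1 : ℕ) : ℝ)) =o[atTop] (fun D : ℕ => (2 : ℝ) ^ D) := by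
    have h := isLittleO_pow_const_const_pow_of_one_lt (R := ℝ) 1 (r := 2) (by norm_num)
    have h' := isLittleO_pow_const_const_pow_of_one_lt (R := ℝ) 0 (r := 2) (by norm_num)
    refine (h.add h').congr_left fun D => by simp
  exact (h₁.add h₂).congr_left fun D => by ring

open Asymptotics Filter in
theorem mainTheorem7 :
    ∃ K : Language Letter,
      K ∈ PEGLanguages Letter ∧
      (∀ D : ℕ, 2 ^ 2 ^ D ≤ numPrefixClasses K ((D + 1) * 2 ^ D) D) ∧
      ∀ t : ℕ → ℝ,
        t =o[Filter.atTop] (fun n : ℕ => (n : ℝ) / Real.log (n : ℝ) ^ 2) →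
        K ∉ Online Letter t := by
  refine ⟨Membership.grammar.language, ⟨_, Membership.grammar_total, rfl⟩,
    Membership.le_numPrefixClasses, ?_⟩
  rintro t ht ⟨M, hM⟩
  obtain ⟨C, hC⟩ := M.exists_card_view_le
  -- Comparing the exponents of the lower and upper bounds on the number of classes.
  have hle : ∀ D : ℕ,
      2 ^ D ≤ C * ((D + 1) * (⌊t ((D + 1) * 2 ^ D + D)⌋₊ + 1) + 1) := fun D =>
    (Nat.pow_le_pow_iff_right (by norm_num)).1
      (((Membership.le_numPrefixClasses D).trans
        (OnlineTM.numPrefixClasses_le_card_view hM _ D)).trans (hC _))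
  have hone : (fun _ : ℕ => (1 : ℝ)) =o[Filter.atTop] (fun D : ℕ => (2 : ℝ) ^ D) := by
    simpa using isLittleO_pow_const_const_pow_of_one_lt (R := ℝ) 0 (r := 2) (by norm_num)
  have hsmall := ((isLittleO_radius ht).add hone).const_mul_left (C : ℝ)
  -- For some `D` the right side of `hle` is at most half of 2^D; any constant below 1 would do.
  obtain ⟨D, hD⟩ := (hsmall.bound (show (0 : ℝ) < 1 / 2 by norm_num)).exists
  rw [Real.norm_of_nonneg (by positivity), Real.norm_of_nonneg (by positivity)] at hD
  have hD' : (2 : ℝ) ^ D ≤ C * (((D + 1 : ℕ) : ℝ) * (⌊t ((D + 1) * 2 ^ D + D)⌋₊ + 1) + 1) := by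
    exact_mod_cast hle D
  have : (0 : ℝ) < 2 ^ D := by positivity
  linarith
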